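/- **Setting.** Identify $\{0,1\}^n$ with the subsets of $[n]$. For $v\in\mathbb R^n$ and $s\subseteq[n]$ let $v\circ s$ be $v$ with all coordinates outside $s$ set to $0$. Let $\|v\|_p=(\sum_i|v_i|^p)^{1/p}$ for real $p>0$ and $\|v\|_0=|\mathrm{supp}(v)|$. For a set system $S\subseteq 2^{[n]}$ define the heavy-hitter dimension $$\mathrm{HHdim}(S)=\sup_{v\in\mathbb R^n}\bigl|\{i\in[n]:\ \exists s\in S,\ \mathrm{supp}(v\circ s)=\{i\}\}\bigr|.$$ An insertion-only stream is a finite sequence $a_1,\dots,a_m\in[n]$; it accumulates to $v=\sum_j e_{a_j}$. A randomized one-pass algorithm keeps a bit string as its memory content, which is updated after each item; the update depends on the memory content, the item, the coin tosses and the number of items read so far. At the end it outputs a function $E:S\to\mathbb R$ that depends on the final memory content and the coin tosses only. The system $S$ and the coin tosses are available for free, and computation is unrestricted. The space used on a stream is the largest length of the memory content at any time. The algorithm $\alpha$-approximates subset-$\ell_p$ on $S$ for streams of length at most $M$ if for every such stream, accumulating to $v$, and every $s\in S$, $\Pr[\|v\circ s\|_p\le E(s)\le\alpha\|v\circ s\|_p]\ge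 0.9$. **Theorem.** Let $S\subseteq\{0,1\}^n$ be non-empty and let $M\ge n$. 1. There is an absolute constant $c>0$ (independent of $n,M,S,p,\alpha$ and the algorithm) such that for all real $p\ge 0$ and $\alpha\ge1$, every randomized one-pass algorithm that $\alpha$-approximates subset-$\ell_p$ on $S$ for insertion-only streams of length at most $M$ uses, on some such stream and with positive probability, at least $c\cdot\mathrm{HHdim}(S)$ bits of space. 2. For every real $p\ge0$ with $p\ne1$ there is a constant $c_p>0$ depending only on $p$ such that, if $S$ has a non-zero member and $\varepsilon\ge 1/\sqrt{\max_{s\in S}\|s\|_0}$, then every randomized one-pass algorithm that $(1+\varepsilon)$-approximates subset-$\ell_p$ on $S$ for insertion-only streams of length at most $M$ uses, on some such stream and with positive probability, at least $c_p\cdot(\mathrm{HHdim}(S)+\varepsilon^{-2})$ bits of space. -/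

import Mathlib

open MeasureTheory

noncomputable section

namespace SubsetLp

variable {n : ℕ}

/-- The vector `v ∘ s`: the coordinates of `v` outside of `s` are set to zero. A binary vector
`s ∈ {0,1}^n` is identified with a subset of the coordinates. -/
def restrict (v : Fin n → ℝ) (s : Finset (Fin n)) : Fin n → ℝ :=
  fun i => if i ∈ s then v i else 0

/-- The `ℓ_p` norm for `0 < p < ∞`, and the size of the support for `p = 0`. -/
def pNorm (p : ℝ) (v : Fin n → ℝ) : ℝ :=
  if p = 0 then ((Function.support v).ncard : ℝ) else (∑ i, |v i| ^ p) ^ (1 / p)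

/-- The coordinates that are heavy hitters of `v` for some set of the system `S`. -/
def heavyHitters (S : Finset (Finset (Fin n))) (v : Fin n → ℝ) : Set (Fin n) :=
  {i | ∃ s ∈ S, Function.support (restrict v s) = {i}}

/-- The heavy-hitter dimension of a set system. -/
def HHdim (S : Finset (Finset (Fin n))) : ℕ :=
  ⨆ v : Fin n → ℝ, (heavyHitters S v).ncard

/-- The supremum in `HHdim` is over a bounded set. -/
theorem bddAbove_ncard_heavyHitters (S : Finset (Finset (Fin n))) :
    BddAbove (Set.range fun v : Fin n → ℝ => (heavyHitters S v).ncard) := by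
  refine ⟨n, ?_⟩
  rintro _ ⟨v, rfl⟩
  simpa using Set.ncard_le_card (heavyHitters S v)

/-- The largest size `max_{s ∈ S} ‖s‖₀` of a member of the set system (`0` if there is none). -/
def maxSize (S : Finset (Finset (Fin n))) : ℕ :=
  S.sup Finset.card

/-- The vector accumulated by an insertion-only stream: each item adds one to a coordinate. -/
def freq (σ : List (Fin n)) : Fin n → ℝ :=
  fun i => (σ.count i : ℝ)

/-- A randomized one-pass algorithm over insertion-only streams of items from `[n]`, which is
queried after the stream on sets from `S`. The memory content is a string of bits; `ω : Ω` is the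
outcome of all coin tosses, to which the algorithm has free access. `update ω t m a` is the new
memory content after reading the item `a` with memory content `m`, after `t` earlier items (so that
fresh coins may be tossed for each item). A query sees only the coins and the memory content.
There is no restriction on the computations in a step, which may depend on `n` and `S`. -/
structure StreamingAlgorithm (n : ℕ) (S : Finset (Finset (Fin n)))
    (Ω : Type*) [MeasurableSpace Ω] where
  init : Ω → List Bool
  update : Ω → ℕ → List Bool → Fin n → List Bool
  query : Ω → List Bool → S → ℝ
  measurable_init : ∀ m, MeasurableSet {ω | init ω = m}
  measurable_update : ∀ t m a m', MeasurableSet {ω | update ω t m a = m'}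
  measurable_query : ∀ m s, Measurable fun ω => query ω m s

namespace StreamingAlgorithm

variable {S : Finset (Finset (Fin n))} {Ω : Type*} [MeasurableSpace Ω]

/-- The memory content after the items of a list have been read, starting with the memory
content `m` after `t` earlier items. -/
def runFrom (A : StreamingAlgorithm n S Ω) (ω : Ω) : ℕ → List Bool → List (Fin n) → List Bool
  | _, m, [] => m
  | t, m, a :: σ => A.runFrom ω (t + 1) (A.update ω t m a) σ

/-- The memory content after the stream `σ`. -/
def memory (A : StreamingAlgorithm n S Ω) (ω : Ω) (σ : List (Fin n)) : List Bool :=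
  A.runFrom ω 0 (A.init ω) σ

/-- The answer `E(s)` after the stream `σ`. -/
def output (A : StreamingAlgorithm n S Ω) (ω : Ω) (σ : List (Fin n)) (s : S) : ℝ :=
  A.query ω (A.memory ω σ) s

/-- The space in bits used on the stream `σ`: the largest length of the memory content at any
time. -/
def space (A : StreamingAlgorithm n S Ω) (ω : Ω) (σ : List (Fin n)) : ℕ :=
  (Finset.range (σ.length + 1)).sup fun t => (A.memory ω (σ.take t)).length

/-- The algorithm solves the `α`-approximation subset-`ℓ_p` problem with respect to `S` on all
insertion-only streams of length at most `M`. -/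
def Solves (A : StreamingAlgorithm n S Ω) (μ : Measure Ω) (M : ℕ) (p α : ℝ) : Prop :=
  ∀ σ : List (Fin n), σ.length ≤ M → ∀ s : S,
    9 / 10 ≤ μ.real {ω | pNorm p (restrict (freq σ) s) ≤ A.output ω σ s ∧
      A.output ω σ s ≤ α * pNorm p (restrict (freq σ) s)}

end StreamingAlgorithm

end SubsetLp

end

/-!
Both lower bounds come from one-way communication. If a map `f ω` turns inputs `x : ι → Bool` into
memory contents of at most `K` bits, from which each question `y` about `x` is answered correctly
with probability at least `9 / 10`, then some outcome `ω` of the coins is right for nine tenths of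
all pairs `(x, y)`, so a fifth of the `x` have at least `7 / 8` of their questions answered
correctly. Two such `x` with the same memory content share the answers to three quarters of the
questions. If this forces them to be within a quarter of the dimension, each memory content
accounts for at most a Hamming ball of that radius, which is an exponentially small part of the
cube, and `K` is linear in the dimension (`card_le_of_one_way`).

* Heavy hitters: let `T` be the set of heavy hitters of a vector that attains `HHdim S`. For every
  `i ∈ T` some `s ∈ S` meets `T` in `{i}` only. After the stream that inserts the elements of `T`
  selected by `x`, the norm on `s` is non-zero exactly if `x i` is true, so any multiplicative
  approximation reveals each bit (`exists_HHdim_le_space`).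
* Accuracy: let `s` be a largest member of `S`, and fix `2 * d ≤ s.card` items of `s`, two for each
  of `d` coordinates. Alice inserts one item of each pair according to `x`, Bob according to `y`. If
  `a` is the number of agreements of `x` and `y`, the `p`-th power of the norm (the norm itself if
  `p = 0`) is `2 * d + (2 ^ p - 2) * a`, so for `p ≠ 1` an accuracy `ε` gives `a` up to an error
  `O(ε * d)`, which is a small multiple of `√d` for `d` a small multiple of `1 / ε ^ 2`. For `x` and
  `x'` at distance more than `d / 4`, the difference of the agreements with a random `y` is a random
  walk of that length, which exceeds such a multiple of `√d` with probability more than `1 / 4`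
  (`card_filter_agree_near_lt`). Hence `x` and `x'` cannot share correct answers for three quarters
  of all `y` (`le_of_solves_of_space_le`).

Dimensions too small for the additive constants need a single bit of memory only, which holds
because an empty memory cannot tell the empty stream from a stream that hits a set of `S`.
-/

noncomputable section

namespace SubsetLp

variable {n : ℕ}

/-! ### Binomial coefficients -/

theorem three_mul_add_one_mul_centralBinom_sq_le (n : ℕ) :
    (3 * n + 1) * n.centralBinom ^ 2 ≤ 16 ^ n := by
  induction n with
  | zero => simp
  | succ n ih =>
    have h := Nat.succ_mul_centralBinom_succ n
    have h2 : (n + 1) ^ 2 * (n + 1).centralBinom ^ 2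
        = 4 * (2 * n + 1) ^ 2 * n.centralBinom ^ 2 := by
      rw [← mul_pow, h]; ring
    have key : (3 * (n + 1) + 1) * (4 * (2 * n + 1) ^ 2) ≤ 16 * (n + 1) ^ 2 * (3 * n + 1) := by
      nlinarith
    have hpos : 0 < (n + 1) ^ 2 := by positivity
    refine Nat.le_of_mul_le_mul_left ?_ hpos
    calc (n + 1) ^ 2 * ((3 * (n + 1) + 1) * (n + 1).centralBinom ^ 2)
        = (3 * (n + 1) + 1) * ((n + 1) ^ 2 * (n + 1).centralBinom ^ 2) := by ring
      _ = (3 * (n + 1) + 1) * (4 * (2 * n + 1) ^ 2) * n.centralBinom ^ 2 := by rw [h2]; ring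
      _ ≤ 16 * (n + 1) ^ 2 * (3 * n + 1) * n.centralBinom ^ 2 := by gcongr
      _ = 16 * (n + 1) ^ 2 * ((3 * n + 1) * n.centralBinom ^ 2) := by ring
      _ ≤ 16 * (n + 1) ^ 2 * 16 ^ n := by gcongr
      _ = (n + 1) ^ 2 * 16 ^ (n + 1) := by ring

theorem mul_choose_sq_le_four_pow (k j : ℕ) : k * k.choose j ^ 2 ≤ 4 ^ k := by
  refine le_trans (b := k * k.choose (k / 2) ^ 2) ?_ ?_
  · gcongr
    exact Nat.choose_le_middle j k
  obtain ⟨n, rfl | rfl⟩ := Nat.even_or_odd' k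
  · have h := three_mul_add_one_mul_centralBinom_sq_le n
    rw [Nat.centralBinom] at h
    rw [Nat.mul_div_cancel_left _ two_pos, pow_mul]
    norm_num
    nlinarith [Nat.zero_le ((2 * n).choose n ^ 2)]
  · have h := three_mul_add_one_mul_centralBinom_sq_le (n + 1)
    have h2 : (n + 1).centralBinom = 2 * (2 * n + 1).choose n := by
      have h3 : (2 * n + 1).choose (n + 1) = (2 * n + 1).choose n := by
        rw [← Nat.choose_symm_of_eq_add]; omega
      rw [Nat.centralBinom, show 2 * (n + 1) = 2 * n + 1 + 1 by ring, Nat.choose_succ_succ, h3]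
      ring
    rw [h2] at h
    rw [show (2 * n + 1) / 2 = n by omega, pow_succ 4, pow_mul]
    norm_num
    rw [pow_succ 16] at h
    nlinarith [Nat.zero_le ((2 * n + 1).choose n ^ 2)]

theorem two_mul_choose_le_two_pow {k : ℕ} (hk : 0 < k) (j : ℕ) : 2 * k.choose j ≤ 2 ^ k := by
  obtain ⟨k, rfl⟩ := Nat.exists_eq_succ_of_ne_zero hk.ne'
  have key : (k + 1).choose j ≤ 2 ^ k := by
    cases j with
    | zero => simpa using Nat.one_le_two_pow
    | succ j =>
      rw [Nat.choose_succ_succ, ← Nat.sum_range_choose]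
      rcases lt_or_ge k (j + 1) with h | h
      · rw [Nat.choose_eq_zero_of_lt h, add_zero]
        rcases lt_or_ge k j with h' | h'
        · rw [Nat.choose_eq_zero_of_lt h']; exact Nat.zero_le _
        · exact Finset.single_le_sum (f := k.choose) (fun _ _ => Nat.zero_le _)
            (Finset.mem_range.2 (by omega))
      · rw [← Finset.sum_pair (f := k.choose) (Nat.succ_ne_self j).symm]
        refine Finset.sum_le_sum_of_subset ?_
        intro i hi
        simp only [Finset.mem_insert, Finset.mem_singleton] at hi
        simp only [Finset.mem_range]
        omega
  rw [pow_succ]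
  simp only [Nat.succ_eq_add_one]
  omega

/-! ### Counting in the Boolean cube -/

/-- The volume bound for a Hamming ball of radius `d / 4`, by comparison with the total mass
`4 ^ d` of the weights `3 ^ (d - hammingDist x x')`. -/
theorem card_hammingBall_pow_four_le {ι : Type*} [Fintype ι] [DecidableEq ι] (x : ι → Bool) :
    (Finset.univ.filter fun x' : ι → Bool => 4 * hammingDist x x' ≤ Fintype.card ι).card ^ 4
      * 27 ^ Fintype.card ι ≤ 256 ^ Fintype.card ι := by
  set d := Fintype.card ι with hd
  set W := Finset.univ.filter fun x' : ι → Bool => 4 * hammingDist x x' ≤ d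
  have hsum : ∑ x' : ι → Bool, 3 ^ (d - hammingDist x x') = 4 ^ d := by
    have h1 : ∀ x' : ι → Bool, 3 ^ (d - hammingDist x x')
        = ∏ i, if x i = x' i then 3 else 1 := by
      intro x'
      rw [Finset.prod_ite, Finset.prod_const_one, mul_one, Finset.prod_const]
      congr 1
      have := Finset.card_filter_add_card_filter_not (s := (Finset.univ : Finset ι))
        (fun i => x i = x' i)
      rw [Finset.card_univ] at this
      unfold hammingDist
      simp only [ne_eq]
      omega
    simp_rw [h1]
    have h2 := Finset.prod_univ_sum (fun _ : ι => (Finset.univ : Finset Bool))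
      (fun i b => if x i = b then 3 else 1)
    rw [Fintype.piFinset_univ] at h2
    rw [← h2]
    have h3 : ∀ i, (∑ b : Bool, if x i = b then 3 else 1) = 4 := by
      intro i; cases x i <;> simp
    rw [Finset.prod_congr rfl fun i _ => h3 i, Finset.prod_const, Finset.card_univ]
  have hW : W.card * 3 ^ ((3 * d + 3) / 4) ≤ 4 ^ d := by
    rw [← hsum, ← smul_eq_mul, ← Finset.sum_const]
    refine le_trans (Finset.sum_le_sum fun x' hx' => ?_)
      (Finset.sum_le_sum_of_subset (Finset.subset_univ W))
    have : 4 * hammingDist x x' ≤ d := (Finset.mem_filter.1 hx').2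
    exact Nat.pow_le_pow_right (by norm_num) (by clear_value d; omega)
  calc W.card ^ 4 * 27 ^ d = W.card ^ 4 * 3 ^ (3 * d) := by rw [pow_mul]; norm_num
    _ ≤ W.card ^ 4 * 3 ^ ((3 * d + 3) / 4 * 4) := by
        refine Nat.mul_le_mul_left _ (Nat.pow_le_pow_right (by norm_num) ?_)
        clear_value d
        omega
    _ = (W.card * 3 ^ ((3 * d + 3) / 4)) ^ 4 := by rw [mul_pow, pow_mul]
    _ ≤ (4 ^ d) ^ 4 := by gcongr
    _ = 256 ^ d := by rw [← pow_mul, mul_comm, pow_mul]; norm_num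

/-- The number of coordinates in which two binary vectors agree. -/
def agree {ι : Type*} [Fintype ι] (x y : ι → Bool) : ℕ :=
  (Finset.univ.filter fun i => x i = y i).card

theorem agree_le {ι : Type*} [Fintype ι] (x y : ι → Bool) : agree x y ≤ Fintype.card ι :=
  Finset.card_le_univ _

/-- Only the coordinates in which `x` and `x'` differ contribute to the difference of the
agreements with `y`, and there each agrees exactly where the other does not. -/
theorem agree_add_hammingDist {ι : Type*} [Fintype ι] [DecidableEq ι] (x x' y : ι → Bool) :
    agree x y + hammingDist x x' = agree x' y
      + 2 * (Finset.univ.filter fun i => x i = y i ∧ x i ≠ x' i).card := by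
  simp only [agree, hammingDist, Finset.card_filter, Finset.mul_sum, ← Finset.sum_add_distrib]
  refine Finset.sum_congr rfl fun i _ => ?_
  cases x i <;> cases x' i <;> cases y i <;> simp

theorem card_filter_card_filter_eq_le {ι : Type*} [Fintype ι] [DecidableEq ι]
    (x x' : ι → Bool) (j : ℕ) :
    (Finset.univ.filter fun y : ι → Bool =>
      (Finset.univ.filter fun i => x i = y i ∧ x i ≠ x' i).card = j).card
      ≤ (hammingDist x x').choose j * 2 ^ (Fintype.card ι - hammingDist x x') := by
  set D := Finset.univ.filter fun i => x i ≠ x' i with hD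
  have hDc : D.card = hammingDist x x' := rfl
  have h : (Finset.powersetCard j D ×ˢ Dᶜ.powerset).card
      = (hammingDist x x').choose j * 2 ^ (Fintype.card ι - hammingDist x x') := by
    rw [Finset.card_product, Finset.card_powersetCard, Finset.card_powerset, Finset.card_compl,
      hDc]
  rw [← h]
  refine Finset.card_le_card_of_injOn (fun y =>
    (Finset.univ.filter fun i => x i = y i ∧ x i ≠ x' i,
      Finset.univ.filter fun i => x i = y i ∧ ¬ x i ≠ x' i)) ?_ ?_
  · intro y hy
    simp only [Finset.coe_filter, Finset.mem_univ, true_and, Set.mem_ofPred_eq] at hy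
    simp only [Finset.coe_product, Set.mem_prod, Finset.mem_coe, Finset.mem_powersetCard,
      Finset.mem_powerset]
    refine ⟨⟨?_, hy⟩, ?_⟩
    · intro i; simp [hD]
    · intro i; simp [hD]
  · intro y _ y' _ hyy
    simp only [Prod.mk.injEq, Finset.ext_iff, Finset.mem_filter, Finset.mem_univ, true_and] at hyy
    funext i
    have h1 := hyy.1 i
    have h2 := hyy.2 i
    by_cases hi : x i = x' i
    · simp only [hi, ne_eq, not_true, not_false_eq_true, and_true] at h2
      revert h2
      cases x' i <;> cases y i <;> cases y' i <;> simp
    · simp only [ne_eq, hi, not_false_eq_true, and_true] at h1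
      revert h1
      cases x i <;> cases y i <;> cases y' i <;> simp

/-- Anti-concentration: if `x` and `x'` are at positive distance `k`, then the difference of their
agreements with a uniformly random `y` is a simple random walk of length `k`; it exceeds `√k / 8`
in absolute value with probability more than `1 / 4`. -/
theorem card_filter_agree_near_lt {ι : Type*} [Fintype ι] [DecidableEq ι] {x x' : ι → Bool}
    (hne : 0 < hammingDist x x') {a : ℕ} (ha : 64 * a ^ 2 ≤ hammingDist x x') :
    4 * (Finset.univ.filter fun y : ι → Bool =>
      agree x y ≤ agree x' y + a ∧ agree x' y ≤ agree x y + a).card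
      < 3 * 2 ^ Fintype.card ι := by
  set k := hammingDist x x' with hk
  have hkd : k ≤ Fintype.card ι := hammingDist_le_card_fintype
  set J := Finset.Icc ((k - a + 1) / 2) ((k + a) / 2) with hJ
  have hJc : J.card ≤ a + 1 := by
    rw [hJ, Nat.card_Icc]; omega
  set c := k.choose (k / 2) with hc
  have hcount : (Finset.univ.filter fun y : ι → Bool =>
      agree x y ≤ agree x' y + a ∧ agree x' y ≤ agree x y + a).card
      ≤ (a + 1) * (c * 2 ^ (Fintype.card ι - k)) := by
    calc _ ≤ (J.biUnion fun j => Finset.univ.filter fun y : ι → Bool =>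
          (Finset.univ.filter fun i => x i = y i ∧ x i ≠ x' i).card = j).card := by
          refine Finset.card_le_card fun y hy => ?_
          simp only [Finset.mem_filter, Finset.mem_univ, true_and] at hy
          have h := agree_add_hammingDist x x' y
          simp only [Finset.mem_biUnion, Finset.mem_filter, Finset.mem_univ, true_and,
            exists_eq_right', hJ, Finset.mem_Icc]
          omega
      _ ≤ ∑ j ∈ J, k.choose j * 2 ^ (Fintype.card ι - k) :=
          Finset.card_biUnion_le.trans
            (Finset.sum_le_sum fun j _ => card_filter_card_filter_eq_le x x' j)
      _ ≤ ∑ j ∈ J, c * 2 ^ (Fintype.card ι - k) := by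
          gcongr with j
          exact Nat.choose_le_middle j k
      _ ≤ (a + 1) * (c * 2 ^ (Fintype.card ι - k)) := by
          rw [Finset.sum_const, smul_eq_mul]; gcongr
  have hmain : 4 * ((a + 1) * c) < 3 * 2 ^ k := by
    have h2k : 0 < 2 ^ k := by positivity
    rcases Nat.eq_zero_or_pos a with rfl | hapos
    · have := two_mul_choose_le_two_pow hne (k / 2)
      omega
    · have h1 : (4 * ((a + 1) * c)) ^ 2 ≤ (2 ^ k) ^ 2 := by
        calc (4 * ((a + 1) * c)) ^ 2 = 16 * (a + 1) ^ 2 * c ^ 2 := by ring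
          _ ≤ k * c ^ 2 := by
              gcongr
              nlinarith
          _ ≤ 4 ^ k := mul_choose_sq_le_four_pow k _
          _ = (2 ^ k) ^ 2 := by rw [← pow_mul, mul_comm, pow_mul]; norm_num
      have h3 := (Nat.pow_le_pow_iff_left two_ne_zero).1 h1
      omega
  calc _ ≤ 4 * ((a + 1) * (c * 2 ^ (Fintype.card ι - k))) := by gcongr
    _ = 4 * ((a + 1) * c) * 2 ^ (Fintype.card ι - k) := by ring
    _ < 3 * 2 ^ k * 2 ^ (Fintype.card ι - k) := by gcongr
    _ = 3 * 2 ^ Fintype.card ι := by rw [mul_assoc, ← pow_add, Nat.add_sub_cancel' hkd]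

theorem card_image_le_of_length_le {α : Type*} (s : Finset α) (f : α → List Bool) (K : ℕ)
    (h : ∀ x ∈ s, (f x).length ≤ K) : (s.image f).card ≤ 2 ^ (K + 1) := by
  calc (s.image f).card ≤ ((Finset.range (K + 1)).biUnion fun k =>
        (Finset.univ : Finset (Fin k → Bool)).image List.ofFn).card := by
        refine Finset.card_le_card fun l hl => ?_
        obtain ⟨x, hx, rfl⟩ := Finset.mem_image.1 hl
        exact Finset.mem_biUnion.2 ⟨(f x).length, Finset.mem_range.2 (by have := h x hx; omega),
          Finset.mem_image.2 ⟨(f x).get, Finset.mem_univ _, List.ofFn_get _⟩⟩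
    _ ≤ ∑ k ∈ Finset.range (K + 1), 2 ^ k := by
        refine Finset.card_biUnion_le.trans (Finset.sum_le_sum fun k _ => ?_)
        refine Finset.card_image_le.trans ?_
        simp [Finset.card_univ]
    _ ≤ 2 ^ (K + 1) := by
        have := Nat.geomSum_lt (m := 2) (n := K + 1) (s := Finset.range (K + 1)) le_rfl
          (fun k hk => Finset.mem_range.1 hk)
        exact this.le

/-! ### The one-way communication bound -/

/-- If at least nine tenths of all pairs are good, at least a fifth of the first components have
at least `7 / 8` of all second components as good partners. -/
theorem card_le_five_mul_card_filter {X Y : Type*} [Fintype X] [Fintype Y] [Nonempty Y]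
    (g : X → Y → Prop) [∀ x, DecidablePred (g x)]
    (h : 9 * (Fintype.card X * Fintype.card Y)
      ≤ 10 * ∑ x, (Finset.univ.filter fun y => g x y).card) :
    Fintype.card X ≤ 5 * (Finset.univ.filter fun x =>
      7 * Fintype.card Y ≤ 8 * (Finset.univ.filter fun y => g x y).card).card := by
  classical
  set B := Finset.univ.filter fun x =>
      7 * Fintype.card Y ≤ 8 * (Finset.univ.filter fun y => g x y).card with hB
  have hY : 0 < Fintype.card Y := Fintype.card_pos
  have hpt : ∀ x, 8 * (Finset.univ.filter fun y => g x y).card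
      ≤ 7 * Fintype.card Y + if x ∈ B then Fintype.card Y else 0 := by
    intro x
    have h1 : (Finset.univ.filter fun y => g x y).card ≤ Fintype.card Y := Finset.card_le_univ _
    split_ifs with hx
    · omega
    · simp only [hB, Finset.mem_filter, Finset.mem_univ, true_and] at hx
      omega
  have hsum := Finset.sum_le_sum fun x (_ : x ∈ Finset.univ) => hpt x
  rw [← Finset.mul_sum, Finset.sum_add_distrib, Finset.sum_const, Finset.card_univ, smul_eq_mul,
    Finset.sum_ite_mem, Finset.univ_inter, Finset.sum_const, smul_eq_mul] at hsum
  have h2 : Fintype.card X * Fintype.card Y ≤ (5 * B.card) * Fintype.card Y := by nlinarith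
  exact Nat.le_of_mul_le_mul_right h2 hY

/-- The deterministic counting step: a single map `f` into bit strings of length at most `K`
cannot serve most pairs `(x, y)`, since each of its fibres contains few of the `x` that have most
`y` as good partners. -/
theorem card_le_of_separated {ι Y : Type*} [Fintype ι] [DecidableEq ι] [Fintype Y]
    [Nonempty Y] (K : ℕ) (f : (ι → Bool) → List Bool) (hK : ∀ x, (f x).length ≤ K)
    (g : (ι → Bool) → Y → Prop) [∀ x, DecidablePred (g x)]
    (hg : 9 * (Fintype.card (ι → Bool) * Fintype.card Y)
      ≤ 10 * ∑ x, (Finset.univ.filter fun y => g x y).card)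
    (hsep : ∀ x x', f x = f x' →
      3 * Fintype.card Y ≤ 4 * (Finset.univ.filter fun y => g x y ∧ g x' y).card →
      4 * hammingDist x x' ≤ Fintype.card ι) :
    Fintype.card ι ≤ 8 * K + 28 := by
  classical
  have hB := card_le_five_mul_card_filter g hg
  set B := Finset.univ.filter fun x =>
      7 * Fintype.card Y ≤ 8 * (Finset.univ.filter fun y => g x y).card
  set ball : (ι → Bool) → ℕ := fun x =>
    (Finset.univ.filter fun x' : ι → Bool => 4 * hammingDist x x' ≤ Fintype.card ι).card
  set N := Finset.univ.sup ball with hN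
  have hN4 : N ^ 4 * 27 ^ Fintype.card ι ≤ 256 ^ Fintype.card ι := by
    obtain ⟨x, -, hx⟩ := Finset.exists_mem_eq_sup Finset.univ Finset.univ_nonempty ball
    rw [hN, hx]
    exact card_hammingBall_pow_four_le x
  have hfib : B.card ≤ N * (B.image f).card := by
    refine Finset.card_le_mul_card_image B N fun m hm => ?_
    obtain ⟨x, hx, rfl⟩ := Finset.mem_image.1 hm
    refine le_trans (Finset.card_le_card fun x' hx' => ?_)
      (Finset.le_sup (f := ball) (Finset.mem_univ x))
    obtain ⟨hx'B, hx'f⟩ := Finset.mem_filter.1 hx'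
    simp only [Finset.mem_filter, Finset.mem_univ, true_and]
    refine hsep x x' hx'f.symm ?_
    have h1 : 7 * Fintype.card Y ≤ 8 * (Finset.univ.filter fun y => g x y).card :=
      (Finset.mem_filter.1 hx).2
    have h2 : 7 * Fintype.card Y ≤ 8 * (Finset.univ.filter fun y => g x' y).card :=
      (Finset.mem_filter.1 hx'B).2
    have h3 := Finset.card_union_add_card_inter (Finset.univ.filter fun y => g x y)
      (Finset.univ.filter fun y => g x' y)
    have h4 : ((Finset.univ.filter fun y => g x y) ∪ (Finset.univ.filter fun y => g x' y)).card
      ≤ Fintype.card Y := Finset.card_le_univ _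
    rw [← Finset.filter_and] at h3
    omega
  have him := card_image_le_of_length_le B f K fun x _ => hK x
  rw [Fintype.card_fun, Fintype.card_bool] at hB
  set d := Fintype.card ι
  have h1 : 2 ^ d ≤ 5 * (N * 2 ^ (K + 1)) :=
    hB.trans (Nat.mul_le_mul_left _ (hfib.trans (Nat.mul_le_mul_left _ him)))
  have h2 : 27 ^ d ≤ 16 ^ d * 2 ^ (4 * K + 14) := by
    have hp : 0 < 16 ^ d := by positivity
    refine Nat.le_of_mul_le_mul_left ?_ hp
    calc 16 ^ d * 27 ^ d = (2 ^ d) ^ 4 * 27 ^ d := by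
          rw [← pow_mul, mul_comm d, pow_mul]; norm_num
      _ ≤ (5 * (N * 2 ^ (K + 1))) ^ 4 * 27 ^ d := by gcongr
      _ = 625 * 2 ^ (4 * K + 4) * (N ^ 4 * 27 ^ d) := by
          rw [show 4 * K + 4 = (K + 1) * 4 by ring, pow_mul]; ring
      _ ≤ 1024 * 2 ^ (4 * K + 4) * 256 ^ d := by gcongr; norm_num
      _ = 256 ^ d * 2 ^ (4 * K + 14) := by
          rw [show 4 * K + 14 = 4 * K + 4 + 10 by ring, pow_add _ _ 10]; ring
      _ = 16 ^ d * (16 ^ d * 2 ^ (4 * K + 14)) := by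
          rw [show 256 = 16 * 16 by norm_num, mul_pow]; ring
  -- Squaring makes `(27 / 16) ^ 2 > 2` available.
  have h3 : 2 ^ d ≤ 2 ^ (8 * K + 28) := by
    have hp : 0 < 256 ^ d := by positivity
    refine Nat.le_of_mul_le_mul_left ?_ hp
    calc 256 ^ d * 2 ^ d = 512 ^ d := by rw [← mul_pow]; norm_num
      _ ≤ 729 ^ d := by gcongr; norm_num
      _ = (27 ^ d) ^ 2 := by rw [← pow_mul, mul_comm, pow_mul]; norm_num
      _ ≤ (16 ^ d * 2 ^ (4 * K + 14)) ^ 2 := by gcongr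
      _ = 256 ^ d * 2 ^ (8 * K + 28) := by
          rw [show 8 * K + 28 = (4 * K + 14) * 2 by ring, pow_mul, mul_pow, ← pow_mul, mul_comm d,
            pow_mul]
          norm_num
  exact (Nat.pow_le_pow_iff_right (by norm_num)).1 h3

/-- **One-way communication bound.** Suppose that for all `x` and `y` the event `G x y`, that the
question `y` about `x` is answered correctly from the message `f ω x`, has probability at least
`9 / 10`. If no message answers three quarters of all questions correctly for two inputs at
distance more than a quarter of the dimension, then the messages are long. -/
theorem card_le_of_one_way {ι Y Ω : Type*} [Fintype ι] [DecidableEq ι] [Fintype Y]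
    [Nonempty Y] [MeasurableSpace Ω] (μ : Measure Ω) [IsProbabilityMeasure μ] (K : ℕ)
    (f : Ω → (ι → Bool) → List Bool) (hK : ∀ x, ∀ᵐ ω ∂μ, (f ω x).length ≤ K)
    (G : (ι → Bool) → Y → Set Ω) (hGm : ∀ x y, MeasurableSet (G x y))
    (hG : ∀ x y, 9 / 10 ≤ μ.real (G x y))
    (hsep : ∀ ω x x', f ω x = f ω x' → ∀ T : Finset Y, (∀ y ∈ T, ω ∈ G x y ∧ ω ∈ G x' y) →
      3 * Fintype.card Y ≤ 4 * T.card → 4 * hammingDist x x' ≤ Fintype.card ι) :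
    Fintype.card ι ≤ 8 * K + 28 := by
  classical
  have hint : ∀ x y, Integrable ((G x y).indicator fun _ => (1 : ℝ)) μ := fun x y =>
    (integrable_const 1).indicator (hGm x y)
  have hint1 : ∀ x, Integrable (fun ω => ∑ y, (G x y).indicator (fun _ => (1 : ℝ)) ω) μ :=
    fun x => integrable_finsetSum _ fun y _ => hint x y
  have hint2 : Integrable (fun ω => ∑ x, ∑ y, (G x y).indicator (fun _ => (1 : ℝ)) ω) μ :=
    integrable_finsetSum _ fun x _ => hint1 x
  obtain ⟨ω, hω, hle⟩ := exists_notMem_null_integral_le hint2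
    (ae_iff.1 (ae_all_iff.2 hK))
  simp only [Set.mem_ofPred_eq, not_not] at hω
  refine card_le_of_separated K (f ω) hω (fun x y => ω ∈ G x y) ?_ fun x x' hxx hc =>
    hsep ω x x' hxx _ (fun y hy => (Finset.mem_filter.1 hy).2) hc
  rw [integral_finsetSum _ fun x _ => hint1 x] at hle
  have h1 : ∀ x, 9 / 10 * (Fintype.card Y : ℝ)
      ≤ ∫ ω, ∑ y, (G x y).indicator (fun _ => (1 : ℝ)) ω ∂μ := by
    intro x
    rw [integral_finsetSum _ fun y _ => hint x y]
    simp_rw [integral_indicator_const (1 : ℝ) (hGm x _), smul_eq_mul, mul_one]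
    refine le_trans (le_of_eq ?_) (Finset.sum_le_sum fun y _ => hG x y)
    rw [Finset.sum_const, Finset.card_univ, nsmul_eq_mul, mul_comm]
  have h2 := (Finset.sum_le_sum fun x (_ : x ∈ Finset.univ) => h1 x).trans hle
  rw [Finset.sum_const, Finset.card_univ, nsmul_eq_mul] at h2
  simp only [Set.indicator_apply, Finset.sum_boole] at h2
  have h3 : (9 : ℝ) * ((Fintype.card (ι → Bool) : ℝ) * Fintype.card Y)
      ≤ 10 * ∑ x, ((Finset.univ.filter fun y => ω ∈ G x y).card : ℝ) := by linarith
  exact_mod_cast h3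

/-! ### Norms of restricted vectors -/

/-- The exponent `q` for which `‖v‖_p ^ q` is a sum over the coordinates: `p` itself for `p ≠ 0`,
and `1` for `p = 0`. -/
def pExp (p : ℝ) : ℝ := if p = 0 then 1 else p

/-- The contribution of a coordinate `t` to `‖v‖_p ^ q`. The case distinction makes up for the
convention `0 ^ 0 = 1`. -/
def pWeight (p t : ℝ) : ℝ := if t = 0 then 0 else |t| ^ p

theorem pExp_pos {p : ℝ} (hp : 0 ≤ p) : 0 < pExp p := by
  unfold pExp
  split_ifs with h
  · exact one_pos
  · exact lt_of_le_of_ne hp (Ne.symm h)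

theorem pWeight_nonneg (p t : ℝ) : 0 ≤ pWeight p t := by
  unfold pWeight
  split_ifs
  · exact le_rfl
  · positivity

theorem pNorm_nonneg (p : ℝ) (v : Fin n → ℝ) : 0 ≤ pNorm p v := by
  unfold pNorm
  split_ifs <;> positivity

theorem pNorm_rpow_pExp {p : ℝ} (hp : 0 ≤ p) (v : Fin n → ℝ) :
    pNorm p v ^ pExp p = ∑ i, pWeight p (v i) := by
  unfold pNorm pExp pWeight
  by_cases h : p = 0
  · subst h
    have h1 : Function.support v = ↑(Finset.univ.filter fun i => v i ≠ 0) := by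
      ext i; simp
    simp only [if_true, Real.rpow_one, Real.rpow_zero]
    rw [h1, Set.ncard_coe_finset, Finset.card_filter]
    push_cast
    exact Finset.sum_congr rfl fun i _ => by by_cases hi : v i = 0 <;> simp [hi]
  · simp only [h, if_false]
    rw [← Real.rpow_mul (by positivity), one_div_mul_cancel h, Real.rpow_one]
    refine Finset.sum_congr rfl fun i _ => ?_
    split_ifs with hi
    · rw [hi, abs_zero, Real.zero_rpow h]
    · rfl

theorem pNorm_zero {p : ℝ} (hp : 0 ≤ p) : pNorm p (0 : Fin n → ℝ) = 0 := by
  have h := pNorm_rpow_pExp hp (0 : Fin n → ℝ)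
  simp only [Pi.zero_apply, pWeight, if_true, Finset.sum_const_zero] at h
  exact ((Real.rpow_eq_zero_iff_of_nonneg (pNorm_nonneg p _)).1 h).1

theorem pNorm_pos {p : ℝ} (hp : 0 ≤ p) {v : Fin n → ℝ} {i : Fin n} (hi : v i ≠ 0) :
    0 < pNorm p v := by
  refine lt_of_le_of_ne (pNorm_nonneg p v) fun h => ?_
  have h1 := pNorm_rpow_pExp hp v
  rw [← h, Real.zero_rpow (pExp_pos hp).ne'] at h1
  have h2 : 0 < pWeight p (v i) := by
    rw [pWeight, if_neg hi]; positivity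
  have h3 := Finset.single_le_sum (fun j _ => pWeight_nonneg p (v j)) (Finset.mem_univ i)
  linarith

theorem one_add_rpow_le {ε q : ℝ} (h0 : 0 ≤ ε) (h1 : ε ≤ 1) (hq : 0 ≤ q) :
    (1 + ε) ^ q ≤ 1 + Real.exp q * ε := by
  have h2 : (1 + ε) ^ q ≤ Real.exp (ε * q) := by
    rw [Real.exp_mul]
    exact Real.rpow_le_rpow (by linarith) (by linarith [Real.add_one_le_exp ε]) hq
  have h3 := convexOn_exp.2 (Set.mem_univ 0) (Set.mem_univ q) (sub_nonneg.2 h1) h0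
    (sub_add_cancel 1 ε)
  simp only [smul_eq_mul, mul_zero, zero_add, Real.exp_zero, mul_one] at h3
  linarith

/-! ### Streams and runs of an algorithm -/

theorem freq_append (σ τ : List (Fin n)) : freq (σ ++ τ) = freq σ + freq τ := by
  funext i
  simp [freq]

theorem freq_toList (u : Finset (Fin n)) (i : Fin n) :
    freq u.toList i = if i ∈ u then 1 else 0 := by
  unfold freq
  split_ifs with h
  · rw [List.count_eq_one_of_mem u.nodup_toList (Finset.mem_toList.2 h), Nat.cast_one]
  · rw [List.count_eq_zero_of_not_mem (fun h' => h (Finset.mem_toList.1 h')), Nat.cast_zero]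

theorem maxSize_le (S : Finset (Finset (Fin n))) : maxSize S ≤ n :=
  Finset.sup_le fun s _ => by simpa using s.card_le_univ

namespace StreamingAlgorithm

variable {S : Finset (Finset (Fin n))} {Ω : Type*} [MeasurableSpace Ω]

theorem runFrom_append (A : StreamingAlgorithm n S Ω) (ω : Ω) (σ τ : List (Fin n)) :
    ∀ (t : ℕ) (m : List Bool),
      A.runFrom ω t m (σ ++ τ) = A.runFrom ω (t + σ.length) (A.runFrom ω t m σ) τ := by
  induction σ with
  | nil => intro t m; rfl
  | cons a σ ih =>
    intro t m
    simp only [List.cons_append, runFrom, List.length_cons]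
    rw [ih, add_right_comm, add_assoc]

theorem output_append_eq (A : StreamingAlgorithm n S Ω) {ω : Ω} {σ σ' : List (Fin n)}
    (hl : σ.length = σ'.length) (hm : A.memory ω σ = A.memory ω σ') (τ : List (Fin n)) (s : S) :
    A.output ω (σ ++ τ) s = A.output ω (σ' ++ τ) s := by
  unfold memory at hm
  unfold output memory
  rw [runFrom_append, runFrom_append, hm, hl]

theorem measurableSet_runFrom (A : StreamingAlgorithm n S Ω) (σ : List (Fin n)) :
    ∀ (t : ℕ) (m m' : List Bool), MeasurableSet {ω | A.runFrom ω t m σ = m'} := by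
  induction σ with
  | nil => intro t m m'; simp [runFrom]
  | cons a σ ih =>
    intro t m m'
    have h : {ω | A.runFrom ω t m (a :: σ) = m'}
        = ⋃ l, {ω | A.update ω t m a = l} ∩ {ω | A.runFrom ω (t + 1) l σ = m'} := by
      ext ω; simp [runFrom]
    rw [h]
    exact MeasurableSet.iUnion fun l => (A.measurable_update t m a l).inter (ih _ _ _)

theorem measurableSet_memory (A : StreamingAlgorithm n S Ω) (σ : List (Fin n)) (m : List Bool) :
    MeasurableSet {ω | A.memory ω σ = m} := by
  have h : {ω | A.memory ω σ = m}
      = ⋃ l, {ω | A.init ω = l} ∩ {ω | A.runFrom ω 0 l σ = m} := by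
    ext ω; simp [memory]
  rw [h]
  exact MeasurableSet.iUnion fun l => (A.measurable_init l).inter (A.measurableSet_runFrom _ _ _ _)

theorem measurable_output (A : StreamingAlgorithm n S Ω) (σ : List (Fin n)) (s : S) :
    Measurable fun ω => A.output ω σ s := by
  intro B hB
  have h : (fun ω => A.output ω σ s) ⁻¹' B
      = ⋃ l, {ω | A.memory ω σ = l} ∩ (fun ω => A.query ω l s) ⁻¹' B := by
    ext ω; simp [output]
  rw [h]
  exact MeasurableSet.iUnion fun l => (A.measurableSet_memory σ l).inter (A.measurable_query l s hB)

theorem length_memory_le_space (A : StreamingAlgorithm n S Ω) (ω : Ω) (σ : List (Fin n)) :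
    (A.memory ω σ).length ≤ A.space ω σ := by
  have h := Finset.le_sup (f := fun t => (A.memory ω (σ.take t)).length)
    (Finset.mem_range.2 (Nat.lt_succ_self σ.length))
  simpa [space] using h

/-- The event that the answer to the query `s` after the stream `σ` is an `α`-approximation. -/
def goodEvent (A : StreamingAlgorithm n S Ω) (p α : ℝ) (σ : List (Fin n)) (s : S) : Set Ω :=
  {ω | pNorm p (restrict (freq σ) s) ≤ A.output ω σ s ∧
    A.output ω σ s ≤ α * pNorm p (restrict (freq σ) s)}

theorem measurableSet_goodEvent (A : StreamingAlgorithm n S Ω) (p α : ℝ) (σ : List (Fin n))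
    (s : S) : MeasurableSet (A.goodEvent p α σ s) :=
  (measurableSet_le measurable_const (A.measurable_output σ s)).inter
    (measurableSet_le (A.measurable_output σ s) measurable_const)

theorem ae_space_lt {A : StreamingAlgorithm n S Ω} {μ : Measure Ω} {M : ℕ} {b : ℝ}
    (h : ¬ ∃ σ : List (Fin n), σ.length ≤ M ∧ 0 < μ {ω | b ≤ (A.space ω σ : ℝ)})
    {σ : List (Fin n)} (hσ : σ.length ≤ M) : ∀ᵐ ω ∂μ, (A.space ω σ : ℝ) < b := by
  push Not at h
  rw [ae_iff]
  simpa using h σ hσ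

end StreamingAlgorithm

/-- Two events of probability `9 / 10` meet, even inside an almost sure event. -/
theorem exists_mem_of_real_ge {Ω : Type*} [MeasurableSpace Ω] {μ : Measure Ω}
    [IsProbabilityMeasure μ] {A B : Set Ω} (hBm : MeasurableSet B) (hA : 9 / 10 ≤ μ.real A)
    (hB : 9 / 10 ≤ μ.real B) {P : Ω → Prop} (hP : ∀ᵐ ω ∂μ, P ω) : ∃ ω ∈ A, ω ∈ B ∧ P ω := by
  by_contra! h
  have h1 : A ≤ᵐ[μ] Bᶜ := by
    filter_upwards [hP] with ω hω hωA hωB using h ω hωA hωB hω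
  have h2 : μ.real A ≤ μ.real Bᶜ :=
    ENNReal.toReal_mono (measure_ne_top μ _) (measure_mono_ae h1)
  rw [probReal_compl_eq_one_sub hBm] at h2
  linarith

/-! ### The heavy-hitter dimension bound -/

/-- The stream that inserts the elements of a set `T` selected by `x`. -/
def indexStream (T : Set (Fin n)) [Fintype T] (x : T → Bool) : List (Fin n) :=
  ((Finset.univ.filter fun i => x i = true).map (Function.Embedding.subtype _)).toList

theorem length_indexStream_le (T : Set (Fin n)) [Fintype T] (x : T → Bool) :
    (indexStream T x).length ≤ n := by
  rw [indexStream, Finset.length_toList]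
  simpa using Finset.card_le_univ
    ((Finset.univ.filter fun i => x i = true).map (Function.Embedding.subtype (· ∈ T)))

theorem freq_indexStream_ne_zero_iff (T : Set (Fin n)) [Fintype T] (x : T → Bool) (j : Fin n) :
    freq (indexStream T x) j ≠ 0 ↔ ∃ h : j ∈ T, x ⟨j, h⟩ = true := by
  rw [indexStream, freq_toList]
  simp

/-- A query set that meets `T` in `{i}` only recovers the bit `x i`, whatever the approximation
factor, because a multiplicative approximation tells zero from non-zero. -/
theorem apply_eq_of_mem_goodEvent {S : Finset (Finset (Fin n))} {Ω : Type*} [MeasurableSpace Ω]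
    {A : StreamingAlgorithm n S Ω} {p α : ℝ} (hp : 0 ≤ p) {T : Set (Fin n)} [Fintype T] {i : T}
    {s : S} (hs : ∀ j ∈ T, j ∈ s.1 ↔ j = i) {x x' : T → Bool} {ω : Ω}
    (hm : A.memory ω (indexStream T x) = A.memory ω (indexStream T x'))
    (h : ω ∈ A.goodEvent p α (indexStream T x) s)
    (h' : ω ∈ A.goodEvent p α (indexStream T x') s) : x i = x' i := by
  have hfalse : ∀ z : T → Bool, z i = false →
      pNorm p (restrict (freq (indexStream T z)) s) = 0 := by
    intro z hz
    rw [show restrict (freq (indexStream T z)) s = 0 from ?_, pNorm_zero hp]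
    funext j
    simp only [restrict, Pi.zero_apply, ite_eq_right_iff]
    intro hj
    by_contra hne
    obtain ⟨hjT, hzj⟩ := (freq_indexStream_ne_zero_iff T z j).1 hne
    have : (⟨j, hjT⟩ : T) = i := Subtype.ext ((hs j hjT).1 hj)
    rw [this, hz] at hzj
    exact Bool.false_ne_true hzj
  have htrue : ∀ z : T → Bool, z i = true →
      0 < pNorm p (restrict (freq (indexStream T z)) s) := by
    intro z hz
    refine pNorm_pos hp (i := i.1) ?_
    rw [restrict, if_pos ((hs i i.2).2 rfl)]
    exact (freq_indexStream_ne_zero_iff T z i).2 ⟨i.2, hz⟩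
  have ho : A.output ω (indexStream T x) s = A.output ω (indexStream T x') s := by
    simp only [StreamingAlgorithm.output, hm]
  obtain ⟨h1, h2⟩ := h
  obtain ⟨h1', h2'⟩ := h'
  rw [ho] at h1 h2
  rcases hx : x i with _ | _ <;> rcases hx' : x' i with _ | _
  · rfl
  · rw [hfalse x hx, mul_zero] at h2
    exact absurd (htrue x' hx') (not_lt.2 (h1'.trans h2))
  · rw [hfalse x' hx', mul_zero] at h2'
    exact absurd (htrue x hx) (not_lt.2 (h1.trans h2'))
  · rfl

theorem exists_HHdim_eq (S : Finset (Finset (Fin n))) :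
    ∃ v : Fin n → ℝ, (heavyHitters S v).ncard = HHdim S :=
  Nat.sSup_mem (Set.range_nonempty _) (bddAbove_ncard_heavyHitters S)

/-- The lower bound by the heavy-hitter dimension: the algorithm solves the one-way problem in
which Alice holds a bit for each heavy hitter and Bob asks for one of the bits. -/
theorem exists_HHdim_le_space {M : ℕ} {S : Finset (Finset (Fin n))} {p α : ℝ}
    (hnM : n ≤ M) (hp : 0 ≤ p) {Ω : Type*} [MeasurableSpace Ω] (μ : Measure Ω)
    [IsProbabilityMeasure μ] (A : StreamingAlgorithm n S Ω) (hA : A.Solves μ M p α) :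
    ∃ σ : List (Fin n), σ.length ≤ M ∧
      0 < μ {ω | 1 / 36 * (HHdim S : ℝ) ≤ (A.space ω σ : ℝ)} := by
  classical
  by_contra hcon
  have hspace : ∀ σ : List (Fin n), σ.length ≤ M → ∀ᵐ ω ∂μ, 36 * A.space ω σ < HHdim S := by
    intro σ hσ
    filter_upwards [StreamingAlgorithm.ae_space_lt hcon hσ] with ω hω
    have : (36 : ℝ) * A.space ω σ < HHdim S := by linarith
    exact_mod_cast this
  have hpos : 0 < HHdim S := by
    obtain ⟨ω, hω⟩ := (hspace [] (Nat.zero_le _)).exists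
    omega
  obtain ⟨v, hv⟩ := exists_HHdim_eq S
  set T := heavyHitters S v with hT
  have hcard : Fintype.card T = HHdim S := by
    rw [← hv, ← Nat.card_coe_set_eq, Nat.card_eq_fintype_card]
  have hne : Nonempty T := Fintype.card_pos_iff.1 (hcard ▸ hpos)
  have hex : ∀ i : T, ∃ s : S, Function.support (restrict v s.1) = {i.1} := fun i => by
    obtain ⟨s, hs, h⟩ := i.2
    exact ⟨⟨s, hs⟩, h⟩
  choose s hs using hex
  have hsT : ∀ i : T, ∀ j ∈ T, j ∈ (s i).1 ↔ j = i := by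
    intro i j hj
    have hvj : v j ≠ 0 := by
      have h1 : j ∈ Function.support (restrict v (s ⟨j, hj⟩).1) := by rw [hs]; rfl
      simp only [Function.mem_support, restrict, ne_eq, ite_eq_right_iff, not_forall] at h1
      exact h1.2
    have h2 : j ∈ Function.support (restrict v (s i).1) ↔ j = i := by rw [hs]; rfl
    simpa [restrict, hvj] using h2
  have hlen : ∀ x, (indexStream T x).length ≤ M := fun x => (length_indexStream_le T x).trans hnM
  have hmem : ∀ x, ∀ᵐ ω ∂μ, 36 * (A.memory ω (indexStream T x)).length < HHdim S := by
    intro x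
    filter_upwards [hspace _ (hlen x)] with ω hω
    have := A.length_memory_le_space ω (indexStream T x)
    omega
  have hbound := card_le_of_one_way μ ((HHdim S - 1) / 36)
    (fun ω (x : T → Bool) => A.memory ω (indexStream T x))
    (fun x => (hmem x).mono fun ω hω => by omega)
    (fun x i => A.goodEvent p α (indexStream T x) (s i))
    (fun x i => A.measurableSet_goodEvent p α _ _)
    (fun x i => hA _ (hlen x) (s i))
    (fun ω x x' hm Y hY hYc => by
      have h1 : Y.card ≤ (Finset.univ.filter fun i => ¬ x i ≠ x' i).card :=
        Finset.card_le_card fun i hi => Finset.mem_filter.2 ⟨Finset.mem_univ _, not_not.2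
          (apply_eq_of_mem_goodEvent hp (hsT i) hm (hY i hi).1 (hY i hi).2)⟩
      have h2 := Finset.card_filter_add_card_filter_not (s := (Finset.univ : Finset T))
        (fun i => x i ≠ x' i)
      rw [Finset.card_univ] at h2
      unfold hammingDist
      omega)
  rw [hcard] at hbound
  -- The communication bound settles dimensions above `36`; below, the memory is empty.
  have hsmall : HHdim S ≤ 36 := by omega
  obtain ⟨i⟩ := hne
  obtain ⟨ω, h1, h2, h3, h4⟩ := exists_mem_of_real_ge
    (A.measurableSet_goodEvent p α _ _)
    (hA _ (hlen fun _ => false) (s i)) (hA _ (hlen fun _ => true) (s i))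
    ((hmem fun _ => false).and (hmem fun _ => true))
  have h5 := List.eq_nil_of_length_eq_zero
    (show (A.memory ω (indexStream T fun _ => false)).length = 0 by omega)
  have h6 := List.eq_nil_of_length_eq_zero
    (show (A.memory ω (indexStream T fun _ => true)).length = 0 by omega)
  exact Bool.false_ne_true
    (apply_eq_of_mem_goodEvent hp (hsT i) (h5.trans h6.symm) h1 h2)

theorem HHdim_pos {S : Finset (Finset (Fin n))} (hS : 0 < maxSize S) : 0 < HHdim S := by
  obtain ⟨s, hs, hpos⟩ := Finset.lt_sup_iff.1 hS
  obtain ⟨i, hi⟩ := Finset.card_pos.1 hpos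
  have hmem : i ∈ heavyHitters S (Pi.single i 1) := by
    refine ⟨s, hs, ?_⟩
    ext j
    by_cases hj : j = i
    · subst hj; simp [restrict, hi]
    · simp [restrict, hj]
  calc 0 < (heavyHitters S (Pi.single i 1)).ncard := (Set.ncard_pos).2 ⟨i, hmem⟩
    _ ≤ HHdim S := le_ciSup (bddAbove_ncard_heavyHitters S) _

/-! ### The accuracy bound -/

/-- The stream that encodes the binary vector `x` by one of two items for each coordinate, such
that the length of the stream does not depend on `x`. -/
def gapStream {d : ℕ} (f : Fin d × Bool ↪ Fin n) (x : Fin d → Bool) : List (Fin n) :=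
  (Finset.univ.image fun k => f (k, x k)).toList

theorem length_gapStream {d : ℕ} (f : Fin d × Bool ↪ Fin n) (x : Fin d → Bool) :
    (gapStream f x).length = d := by
  rw [gapStream, Finset.length_toList, Finset.card_image_of_injective, Finset.card_univ,
    Fintype.card_fin]
  intro k k' h
  exact (Prod.ext_iff.1 (f.injective h)).1

theorem freq_gapStream {d : ℕ} (f : Fin d × Bool ↪ Fin n) (x : Fin d → Bool) (k : Fin d)
    (b : Bool) : freq (gapStream f x) (f (k, b)) = if x k = b then 1 else 0 := by
  rw [gapStream, freq_toList]
  simp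

theorem freq_gapStream_eq_zero {d : ℕ} (f : Fin d × Bool ↪ Fin n) (x : Fin d → Bool) {i : Fin n}
    (hi : i ∉ Set.range f) : freq (gapStream f x) i = 0 := by
  rw [gapStream, freq_toList, if_neg]
  simp only [Finset.mem_image, Finset.mem_univ, true_and, not_exists]
  exact fun k hk => hi ⟨_, hk⟩

/-- A coordinate in which `x` and `y` agree contributes `2 ^ p`, any other one contributes `2`.
For `p ≠ 1` the norm hence reveals the number of agreements. -/
theorem pNorm_rpow_gapStream {d : ℕ} (f : Fin d × Bool ↪ Fin n) {s : Finset (Fin n)}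
    (hf : ∀ z, f z ∈ s) {p : ℝ} (hp : 0 ≤ p) (x y : Fin d → Bool) :
    pNorm p (restrict (freq (gapStream f x ++ gapStream f y)) s) ^ pExp p
      = 2 * d + (2 ^ p - 2) * agree x y := by
  rw [pNorm_rpow_pExp hp, freq_append]
  have h1 : ∑ i, pWeight p (restrict (freq (gapStream f x) + freq (gapStream f y)) s i)
      = ∑ z, pWeight p (restrict (freq (gapStream f x) + freq (gapStream f y)) s (f z)) := by
    rw [← Finset.sum_map Finset.univ f
      (fun i => pWeight p (restrict (freq (gapStream f x) + freq (gapStream f y)) s i))]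
    refine (Finset.sum_subset (Finset.subset_univ _) fun i _ hi => ?_).symm
    have hi' : i ∉ Set.range f := by simpa using hi
    simp [restrict, freq_gapStream_eq_zero f _ hi', pWeight]
  have h2 : ∀ k, (∑ b, pWeight p
      (restrict (freq (gapStream f x) + freq (gapStream f y)) s (f (k, b))))
      = 2 + (2 ^ p - 2) * if x k = y k then 1 else 0 := by
    intro k
    simp only [restrict, hf, if_true, Pi.add_apply, freq_gapStream, Fintype.sum_bool]
    rcases x k <;> rcases y k <;> norm_num [pWeight]
  rw [h1, Fintype.sum_prod_type, Finset.sum_congr rfl fun k _ => h2 k, Finset.sum_add_distrib,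
    ← Finset.mul_sum, Finset.sum_boole, Finset.sum_const, Finset.card_univ, Fintype.card_fin,
    nsmul_eq_mul, mul_comm (d : ℝ)]
  rfl

/-- The factor between the accuracy `ε` of the norm and the relative additive error that it permits
in the number of agreements. The summand `1` makes it bounded away from zero. -/
def errorFactor (p : ℝ) : ℝ := Real.exp (pExp p) * (2 + 2 ^ p) / |2 ^ p - 2| + 1

theorem one_le_errorFactor (p : ℝ) : 1 ≤ errorFactor p := by
  unfold errorFactor
  have : 0 ≤ Real.exp (pExp p) * (2 + 2 ^ p) / |(2 : ℝ) ^ p - 2| := by positivity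
  linarith

theorem two_rpow_sub_two_ne_zero {p : ℝ} (hp1 : p ≠ 1) : (2 : ℝ) ^ p - 2 ≠ 0 := by
  intro h
  have h2 : (2 : ℝ) ^ p = 2 ^ (1 : ℝ) := by rw [Real.rpow_one]; linarith
  exact hp1 ((Real.rpow_right_inj (by norm_num) (by norm_num)).1 h2)

/-- If approximations of the norms for `(x, y)` and `(x', y)` have a common value, the numbers of
agreements are close. -/
theorem abs_agree_sub_le {p ε N N' E : ℝ} {d a a' : ℕ} (hp : 0 ≤ p) (hp1 : p ≠ 1) (h0 : 0 ≤ ε)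
    (h1 : ε ≤ 1) (had : a ≤ d) (had' : a' ≤ d) (hN0 : 0 ≤ N) (hN0' : 0 ≤ N')
    (hN : N ^ pExp p = 2 * d + (2 ^ p - 2) * a) (hN' : N' ^ pExp p = 2 * d + (2 ^ p - 2) * a')
    (hE : N ≤ E) (hE' : E ≤ (1 + ε) * N) (hF : N' ≤ E) (hF' : E ≤ (1 + ε) * N') :
    |(a : ℝ) - a'| ≤ errorFactor p * ε * d := by
  have hq := (pExp_pos hp).le
  have hub : ∀ b : ℕ, b ≤ d → 2 * (d : ℝ) + (2 ^ p - 2) * b ≤ (2 + 2 ^ p) * d := by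
    intro b hb
    have hb' : (b : ℝ) ≤ d := by exact_mod_cast hb
    have h2p : (0 : ℝ) < 2 ^ p := by positivity
    have hb0 : (0 : ℝ) ≤ b := Nat.cast_nonneg b
    nlinarith
  have key : ∀ {U V : ℝ}, 0 ≤ U → 0 ≤ V → U ≤ (1 + ε) * V →
      V ^ pExp p ≤ (2 + 2 ^ p) * d →
      U ^ pExp p - V ^ pExp p ≤ Real.exp (pExp p) * ε * ((2 + 2 ^ p) * d) := by
    intro U V hU hV hUV hVd
    have h2 : U ^ pExp p ≤ (1 + ε) ^ pExp p * V ^ pExp p := by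
      rw [← Real.mul_rpow (by linarith) hV]
      exact Real.rpow_le_rpow hU hUV hq
    have h3 := one_add_rpow_le h0 h1 hq
    have h4 : 0 ≤ V ^ pExp p := by positivity
    have h5 := mul_le_mul_of_nonneg_right h3 h4
    have h6 : Real.exp (pExp p) * ε * V ^ pExp p
        ≤ Real.exp (pExp p) * ε * ((2 + 2 ^ p) * d) := by gcongr
    linarith
  have hA := key hN0 hN0' (hE.trans hF') (hN' ▸ hub a' had')
  have hB := key hN0' hN0 (hF.trans hE') (hN ▸ hub a had)
  rw [hN, hN'] at hA hB
  have habs : |(2 : ℝ) ^ p - 2| * |(a : ℝ) - a'|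
      ≤ Real.exp (pExp p) * ε * ((2 + 2 ^ p) * d) := by
    rw [← abs_mul, abs_le]
    constructor <;> linarith
  have hpos : 0 < |(2 : ℝ) ^ p - 2| := abs_pos.2 (two_rpow_sub_two_ne_zero hp1)
  calc |(a : ℝ) - a'| ≤ Real.exp (pExp p) * ε * ((2 + 2 ^ p) * d) / |(2 : ℝ) ^ p - 2| := by
        rw [le_div_iff₀ hpos]; linarith
    _ = Real.exp (pExp p) * (2 + 2 ^ p) / |(2 : ℝ) ^ p - 2| * ε * d := by ring
    _ ≤ errorFactor p * ε * d := by
        unfold errorFactor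
        gcongr
        linarith

/-- The communication problem behind the accuracy bound: Alice streams an encoding of `x`, Bob one
of `y`, and the norm on a single set `s` approximates the number of agreements of `x` and `y` up to
a small multiple of `√d`. -/
theorem le_of_solves_of_space_le {M d K : ℕ} {S : Finset (Finset (Fin n))} {p ε : ℝ}
    (hp : 0 ≤ p) (hp1 : p ≠ 1) (h0 : 0 ≤ ε) (h1 : ε ≤ 1) {s : Finset (Fin n)} (hs : s ∈ S)
    (hd : 2 * d ≤ s.card) (hdM : 2 * d ≤ M) (hdε : 256 * errorFactor p ^ 2 * ε ^ 2 * d ≤ 1)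
    {Ω : Type*} [MeasurableSpace Ω] (μ : Measure Ω) [IsProbabilityMeasure μ]
    (A : StreamingAlgorithm n S Ω) (hA : A.Solves μ M p (1 + ε))
    (hK : ∀ σ : List (Fin n), σ.length ≤ M → ∀ᵐ ω ∂μ, A.space ω σ ≤ K) :
    d ≤ 8 * K + 28 := by
  classical
  obtain ⟨g⟩ : Nonempty (Fin d × Bool ↪ s) := by
    refine Function.Embedding.nonempty_of_card_le ?_
    simp only [Fintype.card_prod, Fintype.card_fin, Fintype.card_bool, Fintype.card_coe]
    omega
  set f : Fin d × Bool ↪ Fin n := g.trans (Function.Embedding.subtype _)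
  have hf : ∀ z, f z ∈ s := fun z => (g z).2
  set a := ⌊errorFactor p * ε * d⌋₊ with ha
  have hnn : 0 ≤ errorFactor p * ε * d := by
    have := one_le_errorFactor p
    positivity
  have ha2 : 256 * a ^ 2 ≤ d := by
    have h2 : (a : ℝ) ≤ errorFactor p * ε * d := Nat.floor_le hnn
    have h3 : (256 : ℝ) * a ^ 2 ≤ d := by
      calc (256 : ℝ) * a ^ 2 ≤ 256 * (errorFactor p * ε * d) ^ 2 := by gcongr
        _ = (256 * errorFactor p ^ 2 * ε ^ 2 * d) * d := by ring
        _ ≤ 1 * d := by gcongr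
        _ = d := one_mul _
    exact_mod_cast h3
  have hlen : ∀ x y, (gapStream f x ++ gapStream f y).length ≤ M := fun x y => by
    rw [List.length_append, length_gapStream, length_gapStream]; omega
  have hbound := card_le_of_one_way μ K
    (fun ω (x : Fin d → Bool) => A.memory ω (gapStream f x))
    (fun x => (hK (gapStream f x) (by rw [length_gapStream]; omega)).mono fun ω hω =>
      (A.length_memory_le_space ω _).trans hω)
    (fun x y : Fin d → Bool => A.goodEvent p (1 + ε) (gapStream f x ++ gapStream f y) ⟨s, hs⟩)
    (fun x y => A.measurableSet_goodEvent p _ _ _)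
    (fun x y => hA _ (hlen x y) ⟨s, hs⟩)
    (fun ω x x' hm Y hY hYc => by
      by_contra hfar
      rw [Fintype.card_fin] at hfar
      have hsub : Y ⊆ Finset.univ.filter fun y : Fin d → Bool =>
          agree x y ≤ agree x' y + a ∧ agree x' y ≤ agree x y + a := by
        intro y hy
        obtain ⟨⟨hE, hE'⟩, ⟨hF, hF'⟩⟩ := hY y hy
        rw [← A.output_append_eq (by rw [length_gapStream, length_gapStream]) hm] at hF hF'
        have hnear := abs_agree_sub_le hp hp1 h0 h1
          ((agree_le x y).trans_eq (Fintype.card_fin d))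
          ((agree_le x' y).trans_eq (Fintype.card_fin d)) (pNorm_nonneg p _) (pNorm_nonneg p _)
          (pNorm_rpow_gapStream f hf hp x y) (pNorm_rpow_gapStream f hf hp x' y) hE hE' hF hF'
        have hlt := Nat.lt_floor_add_one (errorFactor p * ε * d)
        rw [← ha] at hlt
        obtain ⟨hl, hr⟩ := abs_le.1 hnear
        have h4 : (agree x y : ℝ) < agree x' y + (a + 1) := by linarith
        have h5 : (agree x' y : ℝ) < agree x y + (a + 1) := by linarith
        have h6 : agree x y < agree x' y + (a + 1) := by exact_mod_cast h4
        have h7 : agree x' y < agree x y + (a + 1) := by exact_mod_cast h5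
        simp only [Finset.mem_filter, Finset.mem_univ, true_and]
        omega
      have hlt := card_filter_agree_near_lt (x := x) (x' := x') (a := a) (by omega) (by omega)
      have hle := Finset.card_le_card hsub
      rw [Fintype.card_fun, Fintype.card_bool] at hYc
      omega)
  rwa [Fintype.card_fin] at hbound

/-- The constant of the accuracy bound: a hundredth of the largest `κ` for which dimension
`κ / ε ^ 2` is admissible in `le_of_solves_of_space_le`. -/
def accuracyConst (p : ℝ) : ℝ := 1 / (25600 * errorFactor p ^ 2)

theorem accuracyConst_pos (p : ℝ) : 0 < accuracyConst p := by
  have := one_le_errorFactor p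
  unfold accuracyConst
  positivity

/-- The lower bound by the inverse square of the accuracy. -/
theorem exists_accuracy_le_space {M : ℕ} {S : Finset (Finset (Fin n))} {p ε : ℝ}
    (hS : S.Nonempty) (hnM : n ≤ M) (hp : 0 ≤ p) (hp1 : p ≠ 1) (hm : 0 < maxSize S)
    (hε : 1 / √(maxSize S : ℝ) ≤ ε) {Ω : Type*} [MeasurableSpace Ω] (μ : Measure Ω)
    [IsProbabilityMeasure μ] (A : StreamingAlgorithm n S Ω) (hA : A.Solves μ M p (1 + ε)) :
    ∃ σ : List (Fin n), σ.length ≤ M ∧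
      0 < μ {ω | accuracyConst p * (1 / ε ^ 2) ≤ (A.space ω σ : ℝ)} := by
  have hL := one_le_errorFactor p
  have hm' : (0 : ℝ) < maxSize S := by exact_mod_cast hm
  have hε0 : 0 < ε := lt_of_lt_of_le (by positivity) hε
  have hεm : 1 / ε ^ 2 ≤ maxSize S := by
    rw [div_le_iff₀ (Real.sqrt_pos.2 hm')] at hε
    rw [div_le_iff₀ (by positivity)]
    calc (1 : ℝ) = 1 ^ 2 := (one_pow 2).symm
      _ ≤ (ε * √(maxSize S : ℝ)) ^ 2 := by gcongr
      _ = maxSize S * ε ^ 2 := by rw [mul_pow, Real.sq_sqrt hm'.le]; ring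
  set κ := 1 / (256 * errorFactor p ^ 2) with hκ
  have hκ0 : 0 < κ := by positivity
  have hκ1 : κ ≤ 1 / 256 := by
    rw [hκ]
    gcongr
    nlinarith
  have hc : accuracyConst p = κ / 100 := by
    rw [accuracyConst, hκ, div_div]; ring_nf
  rcases le_or_gt (accuracyConst p * (1 / ε ^ 2)) 1 with hsmall | hlarge
  -- One bit suffices for a target of at most `1`, and the heavy-hitter bound provides it.
  · obtain ⟨σ, hσ, hμ⟩ := exists_HHdim_le_space hnM hp μ A hA
    refine ⟨σ, hσ, hμ.trans_le (measure_mono fun ω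
      (hω : 1 / 36 * (HHdim S : ℝ) ≤ (A.space ω σ : ℝ)) => ?_)⟩
    have hH : (0 : ℝ) < HHdim S := by exact_mod_cast HHdim_pos hm
    have hsp : (0 : ℝ) < A.space ω σ := by linarith
    have hsp1 : (1 : ℝ) ≤ A.space ω σ := by exact_mod_cast hsp
    exact hsmall.trans hsp1
  -- Otherwise `κ / ε ^ 2 > 100`, which absorbs the rounding and the additive constant `28`.
  · by_contra hcon
    set u := 1 / ε ^ 2 with hu
    have hu0 : 0 < u := by positivity
    have huε : u * ε ^ 2 = 1 := by rw [hu]; field_simp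
    rw [hc] at hlarge hcon
    have hε1 : ε ≤ 1 := by
      by_contra! hgt
      have : u ≤ 1 := by
        rw [hu, div_le_one (by positivity)]; nlinarith
      nlinarith
    obtain ⟨s, hs, hsm⟩ := Finset.exists_mem_eq_sup S hS Finset.card
    change maxSize S = s.card at hsm
    set d := ⌊κ * u⌋₊ with hd
    have hdle : (d : ℝ) ≤ κ * u := Nat.floor_le (by positivity)
    have hdlt : κ * u < d + 1 := Nat.lt_floor_add_one _
    have h2d : 2 * d ≤ s.card := by
      rw [← hsm]
      have : (2 : ℝ) * d ≤ maxSize S := by nlinarith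
      exact_mod_cast this
    have hdε : 256 * errorFactor p ^ 2 * ε ^ 2 * d ≤ 1 := by
      calc 256 * errorFactor p ^ 2 * ε ^ 2 * d
          ≤ 256 * errorFactor p ^ 2 * ε ^ 2 * (κ * u) := by gcongr
        _ = (256 * errorFactor p ^ 2 * κ) * (u * ε ^ 2) := by ring
        _ = 1 := by rw [huε, hκ]; field_simp
    have hbound := le_of_solves_of_space_le (K := ⌊κ / 100 * u⌋₊) hp hp1 hε0.le hε1 hs h2d
      ((hsm ▸ h2d).trans ((maxSize_le S).trans hnM)) hdε μ A hA fun σ hσ => by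
        filter_upwards [StreamingAlgorithm.ae_space_lt hcon hσ] with ω hω
        exact Nat.le_floor hω.le
    have hK : ((⌊κ / 100 * u⌋₊ : ℕ) : ℝ) ≤ κ / 100 * u := Nat.floor_le (by positivity)
    have hb : (d : ℝ) ≤ 8 * (⌊κ / 100 * u⌋₊ : ℕ) + 28 := by exact_mod_cast hbound
    linarith

end SubsetLp

end

theorem mainTheorem2 :
    (∃ c : ℝ, 0 < c ∧
      ∀ (n M : ℕ) (S : Finset (Finset (Fin n))) (p α : ℝ),
        S.Nonempty → n ≤ M → 0 ≤ p → 1 ≤ α →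
      ∀ (Ω : Type*) [MeasurableSpace Ω] (μ : Measure Ω) [IsProbabilityMeasure μ]
        (A : SubsetLp.StreamingAlgorithm n S Ω), A.Solves μ M p α →
      ∃ σ : List (Fin n), σ.length ≤ M ∧
        0 < μ {ω | c * (SubsetLp.HHdim S : ℝ) ≤ (A.space ω σ : ℝ)}) ∧
    (∀ p : ℝ, 0 ≤ p → p ≠ 1 → ∃ c : ℝ, 0 < c ∧
      ∀ (n M : ℕ) (S : Finset (Finset (Fin n))) (ε : ℝ),
        S.Nonempty → n ≤ M → 0 < SubsetLp.maxSize S → 1 / √(SubsetLp.maxSize S : ℝ) ≤ ε →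
      ∀ (Ω : Type*) [MeasurableSpace Ω] (μ : Measure Ω) [IsProbabilityMeasure μ]
        (A : SubsetLp.StreamingAlgorithm n S Ω), A.Solves μ M p (1 + ε) →
      ∃ σ : List (Fin n), σ.length ≤ M ∧
        0 < μ {ω | c * ((SubsetLp.HHdim S : ℝ) + 1 / ε ^ 2) ≤ (A.space ω σ : ℝ)}) := by
  refine ⟨⟨1 / 36, by norm_num, ?_⟩, fun p hp hp1 =>
    ⟨min (1 / 36) (SubsetLp.accuracyConst p) / 2, ?_, ?_⟩⟩
  · intro n M S p α _ hnM hp _ Ω _ μ _ A hA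
    exact SubsetLp.exists_HHdim_le_space hnM hp μ A hA
  · have := SubsetLp.accuracyConst_pos p
    positivity
  · intro n M S ε hS hnM hm hε Ω _ μ _ A hA
    obtain ⟨σ, hσ, hμ⟩ := SubsetLp.exists_HHdim_le_space hnM hp μ A hA
    obtain ⟨σ', hσ', hμ'⟩ := SubsetLp.exists_accuracy_le_space hS hnM hp hp1 hm hε μ A hA
    have h1 : min (1 / 36) (SubsetLp.accuracyConst p) * (SubsetLp.HHdim S : ℝ)
        ≤ 1 / 36 * SubsetLp.HHdim S := by
      gcongr
      exact min_le_left _ _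
    have h2 : min (1 / 36) (SubsetLp.accuracyConst p) * (1 / ε ^ 2)
        ≤ SubsetLp.accuracyConst p * (1 / ε ^ 2) := by
      gcongr
      exact min_le_right _ _
    -- The mean of the two bounds is at most the larger one.
    rcases le_total (1 / 36 * (SubsetLp.HHdim S : ℝ))
      (SubsetLp.accuracyConst p * (1 / ε ^ 2)) with h | h
    · refine ⟨σ', hσ', hμ'.trans_le (measure_mono fun ω (hω : _ ≤ (A.space ω σ' : ℝ)) => ?_)⟩
      change _ ≤ (A.space ω σ' : ℝ)
      linarith
    · refine ⟨σ, hσ, hμ.trans_le (measure_mono fun ω (hω : _ ≤ (A.space ω σ : ℝ)) => ?_)⟩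
      change _ ≤ (A.space ω σ : ℝ)
      linarith
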